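/- **Theorem.** There are $n$ tasks and $n$ resources. The load of a resource is the number of tasks on it, and an assignment is the load vector $x=(x_1,\dots,x_n)$. In each round all tasks act simultaneously and independently, on the basis of the loads $X(t)=x$ at the start of the round: a task on resource $i$ chooses a resource $j\in\{1,\dots,n\}$ uniformly at random and, if $x_i>x_j$, moves to $j$ with probability $1-x_j/x_i$ (otherwise it stays). This gives the loads $X(t+1)$. The process starts from $X(0)=(n,0,\dots,0)$. An assignment is a Nash equilibrium if $|x_i-x_j|\le 1$ for all $i,j$ (here: one task on each resource). Let $T$ be the first time at which $X(t)$ is a Nash equilibrium, and let $n_0(x)$ be the number of resources $i$ with $x_i=0$. There are an absolute constant $c>0$ and an $N$ such that for all $n\ge N$: 1. $e^{c\sqrt n}\le \mathbb E[T]<\infty$, that is, the expected time to reach the Nash equilibrium is finite and at least $\exp(\Omega(\sqrt n))$; 2. for every allocation of the $n$ tasks to the $n$ resources whose load vector $x$ satisfies $n_0(x)\ge\lfloor\sqrt n\rfloor$, the load vector $x'$ after one round of the protocol satisfies $\Pr\bigl(n_0(x')<\lfloor\sqrt n\rfloor\bigr)\le e^{-c\sqrt n}$. -/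

import Mathlib

open MeasureTheory
open scoped NNReal ENNReal

namespace LoadBalancing

/-- An allocation of `m` individual tasks to `n` resources: task `b` uses resource `a b`. -/
abbrev Allocation (m n : ℕ) : Type := Fin m → Fin n

/-- The assignment (load vector) of an allocation: `load a i` tasks use resource `i`. -/
def load {m n : ℕ} (a : Allocation m n) (i : Fin n) : ℕ :=
  (Finset.univ.filter fun b => a b = i).card

/-- The assignment `x` is a Nash equilibrium: all loads differ by at most one. -/
def IsNash {n : ℕ} (x : Fin n → ℕ) : Prop :=
  ∀ i j : Fin n, |(x i : ℤ) - (x j : ℤ)| ≤ 1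

/-- The number of empty resources in the assignment `x`. -/
def numEmpty {n : ℕ} (x : Fin n → ℕ) : ℕ :=
  (Finset.univ.filter fun i => x i = 0).card

/-- The assignment `(m, 0, …, 0)`. -/
def allOnFirst (m n : ℕ) (i : Fin n) : ℕ :=
  if (i : ℕ) = 0 then m else 0

/-- The probability with which a task on resource `i` that has looked at resource `j` moves
there, when the loads are `x`. -/
noncomputable def moveProb {n : ℕ} (x : Fin n → ℕ) (i j : Fin n) : ℝ≥0 :=
  if x j < x i then 1 - (x j : ℝ≥0) / (x i : ℝ≥0) else 0

theorem moveProb_le_one {n : ℕ} (x : Fin n → ℕ) (i j : Fin n) : moveProb x i j ≤ 1 := by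
  unfold moveProb
  split_ifs
  · exact tsub_le_self
  · exact zero_le_one

/-- A coin that shows `true` with probability `p`. -/
noncomputable def coin (p : ℝ≥0) (hp : p ≤ 1) : PMF Bool :=
  PMF.ofFintype (fun b => if b then (p : ℝ≥0∞) else ((1 - p : ℝ≥0) : ℝ≥0∞)) (by
    rw [Fintype.sum_bool]
    simp only [if_true, Bool.false_eq_true, if_false]
    rw [← ENNReal.coe_add, add_tsub_cancel_of_le hp, ENNReal.coe_one])

/-- What one task on resource `i` does in one round, when the current loads are `x`: it chooses a
resource `j` uniformly at random, and moves to `j` with probability `moveProb x i j`. The value is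
the resource used by the task after the round. -/
noncomputable def taskStep {n : ℕ} (x : Fin n → ℕ) (i : Fin n) : PMF (Fin n) :=
  haveI : Nonempty (Fin n) := ⟨i⟩
  (PMF.uniformOfFintype (Fin n)).bind fun j =>
    (coin (moveProb x i j) (moveProb_le_one x i j)).map fun c => if c then j else i

/-- One round of the protocol with neutral moves, started from the allocation `a`: all tasks act
independently and in parallel, on the basis of the current loads. -/
noncomputable def round {m n : ℕ} (a : Allocation m n) : PMF (Allocation m n) :=
  PMF.ofFintype (fun a' => ∏ b : Fin m, taskStep (load a) (a b) (a' b)) (by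
    rw [← Fintype.piFinset_univ,
      ← Finset.prod_univ_sum (fun _ => Finset.univ) (fun b j => taskStep (load a) (a b) j)]
    refine Finset.prod_eq_one fun b _ => ?_
    have h := (taskStep (load a) (a b)).tsum_coe
    rwa [tsum_fintype] at h)

/-- The random allocations `A 0, A 1, …` evolve by the protocol with neutral moves: they form a
Markov chain with one-step transition law `round`. -/
structure IsProtocolProcess {m n : ℕ} {Ω : Type*} [MeasurableSpace Ω] (P : Measure Ω)
    (A : ℕ → Ω → Allocation m n) : Prop where
  measurable : ∀ t, Measurable (A t)
  markov : ∀ (t : ℕ) (a : ℕ → Allocation m n),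
    P {ω | ∀ s ≤ t + 1, A s ω = a s} = P {ω | ∀ s ≤ t, A s ω = a s} * round (a t) (a (t + 1))

/-- The first time at which the assignment is a Nash equilibrium (`∞` if that never happens). -/
noncomputable def nashTime {m n : ℕ} {Ω : Type*} (A : ℕ → Ω → Allocation m n) (ω : Ω) : ℝ≥0∞ :=
  ⨅ (t : ℕ) (_ : IsNash (load (A t ω))), (t : ℝ≥0∞)

open ProbabilityTheory Preorder Finset in
theorem trajMeasure_dirac_zero {S : Type*} [MeasurableSpace S] [DiscreteMeasurableSpace S] (a₀ : S) (κ : (t : ℕ) → Kernel (Π _ : Iic t, S) S)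
   [∀ t, IsMarkovKernel (κ t)] : ∀ᵐ ω ∂(Kernel.trajMeasure (X := fun _ => S) (Measure.dirac a₀) κ), ω 0 = a₀ := by
  have e : Kernel.trajMeasure (X := fun _ => S) (Measure.dirac a₀) κ = Kernel.traj (X := fun _ => S) κ 0 ((MeasurableEquiv.piUnique fun _ : Iic 0 => S).symm a₀) := by
    unfold Kernel.trajMeasure
    have e1 := Measure.map_dirac' (MeasurableEquiv.piUnique (fun _ : Iic 0 => S)).symm.measurable a₀
    refine (congrArg (fun μ => Measure.bind μ (Kernel.traj (X := fun _ => S) κ 0)) e1).trans ?_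
    exact Measure.dirac_bind (Kernel.measurable _) _
  rw [e]
  have h := Kernel.traj_map_frestrictLe_apply (X := fun _ => S) (κ := κ) 0 0 ((MeasurableEquiv.piUnique fun _ : Iic 0 => S).symm a₀)
  rw [Kernel.partialTraj_self, Kernel.id_apply] at h
  have h3 : ∀ᵐ z ∂(Measure.map (frestrictLe (π := fun _ => S) 0) (Kernel.traj (X := fun _ => S) κ 0 ((MeasurableEquiv.piUnique fun _ : Iic 0 => S).symm a₀))), z ⟨0, by simp⟩ = a₀ := by
    rw [h, ae_dirac_iff]
    · rfl
    · exact (measurable_pi_apply (X := fun _ : Iic 0 => S) _) (MeasurableSet.of_discrete (s := {a₀}))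
  exact ae_of_ae_map (by fun_prop) h3

open ProbabilityTheory Preorder Finset in
/-- The process exists, from every initial allocation. -/
theorem exists_isProtocolProcess {m n : ℕ} (a₀ : Allocation m n) :
    ∃ P : Measure (ℕ → Allocation m n), IsProbabilityMeasure P ∧
      IsProtocolProcess P (fun t ω => ω t) ∧ ∀ᵐ ω ∂P, ω 0 = a₀ := by
  let κ : (t : ℕ) → Kernel (Π _ : Iic t, Allocation m n) (Allocation m n) := fun t =>
    ⟨fun h => (round (h ⟨t, by simp⟩)).toMeasure, by
      exact (Measurable.of_discrete (f := fun a : Allocation m n => (round a).toMeasure)).comp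
        (measurable_pi_apply _)⟩
  have : ∀ t, IsMarkovKernel (κ t) := fun t => ⟨fun h => by
    change IsProbabilityMeasure (round (h ⟨t, by simp⟩)).toMeasure
    infer_instance⟩
  refine ⟨Kernel.trajMeasure (X := fun _ => Allocation m n) (Measure.dirac a₀) κ, inferInstance,
    ⟨fun t => measurable_pi_apply t, fun t a => ?_⟩, trajMeasure_dirac_zero a₀ κ⟩
  have h := Kernel.map_frestrictLe_trajMeasure_compProd_eq_map_trajMeasure
      (X := fun _ => Allocation m n) (μ₀ := Measure.dirac a₀) (κ := κ) (a := t)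
  have h2 := congrArg (fun μ => μ ({frestrictLe t a} ×ˢ {a (t + 1)})) h
  beta_reduce at h2
  rw [Measure.compProd_apply_prod (measurableSet_singleton _) (measurableSet_singleton _),
      Measure.map_apply (by fun_prop) (measurableSet_singleton _ |>.prod (measurableSet_singleton _)),
      lintegral_singleton, Measure.map_apply (by fun_prop) (measurableSet_singleton _)] at h2
  have hk : κ t (frestrictLe t a) {a (t + 1)} = round (a t) (a (t + 1)) :=
    PMF.toMeasure_apply_singleton _ _ (measurableSet_singleton _)
  rw [hk] at h2
  clear hk h
  rw [mul_comm]
  clear_value κ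
  convert h2.symm using 2
  · ext ω
    simp only [Nat.le_succ_iff_eq_or_le, Set.mem_preimage, Set.mem_prod, Set.mem_singleton_iff, Set.mem_ofPred_eq]
    constructor
    · intro h
      exact ⟨funext fun s => h s (Or.inr (mem_Iic.1 s.2)), h _ (Or.inl rfl)⟩
    · rintro ⟨h, h'⟩ s (rfl | hs)
      · exact h'
      · exact congrFun h ⟨s, mem_Iic.2 hs⟩
  · congr 1
    ext ω
    exact ⟨fun h => funext fun s => h s (mem_Iic.1 s.2), fun h s hs => congrFun h ⟨s, mem_Iic.2 hs⟩⟩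

end LoadBalancing

/-!
Write `k` for the number of empty resources of an allocation of `n` tasks to `n` resources, and
suppose `k ≥ ⌊√n⌋`. The round that follows leaves at least `⌊√n⌋` resources empty, except with
probability `exp (-Ω(√n))`, for two reasons.

* A task hits a given empty resource with probability exactly `1 / n`. So an empty resource stays
  empty with probability about `1 / e`, and these events are negatively dependent: the generating
  function of the number of empty resources that stay empty is bounded by that of independent events
  (`sum_prod_mul_pow_card_unhit_le`). Hence at least `k / 8` of them stay empty with high probability
  (`sum_numStayEmpty_lt_le`), which settles the case `k ≥ 8 ⌊√n⌋`.
* If `k < 8 ⌊√n⌋`, then all but `2 k` tasks are alone on their resource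
  (`le_card_singleTasks_add`). Such a task moves only to empty resources, with total probability
  `k / n`, independently of the others. The remaining tasks, at most `2 k` in number, can land on at
  most `2 k` of the resources with a single task. Conditionally on where they land, the number of
  single tasks that leave their resource empty behind them therefore dominates a binomial variable
  with at least `n - 4 k` trials and mean about `k`, so it is at least `7 k / 8` with high probability
  (`sum_prod_mul_pow_card_vacated_le`, `sum_numVacated_lt_le`). Together with the `k / 8` resources
  that stay empty this gives at least `k` empty resources.

Since a Nash equilibrium has no empty resource, and the process starts with `n - 1` of them, a union
bound over the rounds (`IsProtocolProcess.le_lintegral_nashTime`) bounds the expected time from below.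

The expected time is finite because from every allocation a single round reaches a Nash equilibrium
with probability at least `n⁻ⁿ` (`inv_pow_le_round_isNash`): one task of each occupied resource stays,
and the others spread over the empty resources. So the time has a geometric tail.
-/

namespace LoadBalancing

/-! ### Generating functions for independent balls -/

theorem pow_add_mul_pow_le_add_pow {w y : ℝ} (hw : 0 ≤ w) (hy : 0 ≤ y) (k : ℕ) :
    w ^ (k + 1) + (k + 1) * (y * w ^ k) ≤ (w + y) ^ (k + 1) := by
  induction k with
  | zero => simp
  | succ k ih =>
    have h := mul_le_mul_of_nonneg_right ih (add_nonneg hw hy)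
    have h2 : 0 ≤ (k + 1) * (y * w ^ k) * y := by positivity
    rw [pow_succ (w + y)]
    refine le_trans ?_ h
    push_cast
    ring_nf at h2 ⊢
    nlinarith

theorem sum_prod_weight_eq_one {β ι : Type*} [Fintype β] [DecidableEq β] [Fintype ι]
    {p : β → ι → ℝ} (h1 : ∀ b, ∑ j, p b j = 1) : ∑ f : β → ι, ∏ b, p b (f b) = 1 := by
  rw [← Fintype.piFinset_univ, ← Finset.prod_univ_sum (fun _ => Finset.univ) (fun b j => p b j)]
  exact Finset.prod_eq_one fun b _ => h1 b

/-- A single ball: it removes its site from `K`, and any given site with probability at most `q`.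
The bound is the generating function of `K.card` independent survivals. -/
theorem sum_weight_mul_pow_card_erase_le {ι : Type*} [Fintype ι] [DecidableEq ι]
    {q w : ℝ} (hq0 : 0 ≤ q) (hw0 : 0 ≤ w) (hw1 : w ≤ 1) {p : ι → ℝ}
    (h1 : ∑ j, p j = 1) (K : Finset ι) (hK : ∀ j ∈ K, p j ≤ q) :
    ∑ j, p j * w ^ (K.erase j).card ≤ (1 - (1 - w) * (1 - q)) ^ K.card := by
  have e : ∀ j, p j * w ^ (K.erase j).card =
      p j * w ^ K.card + if j ∈ K then p j * (w ^ (K.card - 1) - w ^ K.card) else 0 := by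
    intro j
    split_ifs with h
    · rw [Finset.card_erase_of_mem h]; ring
    · rw [Finset.erase_eq_of_notMem h]; ring
  simp_rw [e]
  rw [Finset.sum_add_distrib, ← Finset.sum_mul, h1, one_mul, Finset.sum_ite_mem,
    Finset.univ_inter]
  rcases hc : K.card with _ | k
  · rw [Finset.card_eq_zero] at hc
    simp [hc]
  · have hb : ∑ j ∈ K, p j * (w ^ (k + 1 - 1) - w ^ (k + 1)) ≤
        ∑ j ∈ K, q * (w ^ k - w ^ (k + 1)) := by
      refine Finset.sum_le_sum fun j hj => ?_
      rw [Nat.add_sub_cancel]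
      exact mul_le_mul_of_nonneg_right (hK j hj)
        (sub_nonneg.2 (pow_le_pow_of_le_one hw0 hw1 k.le_succ))
    rw [Finset.sum_const, hc, nsmul_eq_mul] at hb
    have h2 := pow_add_mul_pow_le_add_pow hw0 (mul_nonneg hq0 (sub_nonneg.2 hw1)) k
    have e2 : 1 - (1 - w) * (1 - q) = w + q * (1 - w) := by ring
    rw [e2]
    refine le_trans ?_ h2
    refine (add_le_add_right hb _).trans (le_of_eq ?_)
    push_cast
    ring

/-- Negative dependence of the events that a site stays empty, in the form of a generating
function: `m` independent balls, each of which hits any given site of `K` with probability at most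
`q`, leave a number of sites of `K` empty whose generating function on `[0, 1]` is at most the one
for independent sites. -/
theorem sum_prod_mul_pow_card_unhit_le {ι : Type*} [Fintype ι] [DecidableEq ι]
    {q v : ℝ} (hq0 : 0 ≤ q) (hq1 : q ≤ 1) (hv0 : 0 ≤ v) (hv1 : v ≤ 1) :
    ∀ (m : ℕ) (p : Fin m → ι → ℝ), (∀ b j, 0 ≤ p b j) → (∀ b, ∑ j, p b j = 1) →
      ∀ K : Finset ι, (∀ b, ∀ j ∈ K, p b j ≤ q) →
      ∑ f : Fin m → ι, (∏ b, p b (f b)) * v ^ (K.filter fun j => ∀ b, f b ≠ j).card ≤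
        (1 - (1 - v) * (1 - q) ^ m) ^ K.card := by
  intro m
  induction m with
  | zero => intro p _ _ K _; simp
  | succ m ih =>
    intro p hp h1 K hK
    have hpow0 : 0 ≤ (1 - q) ^ m := pow_nonneg (by linarith) _
    have hpow1 : (1 - q) ^ m ≤ 1 := pow_le_one₀ (by linarith) (by linarith)
    rw [← (Fin.consEquiv fun _ => ι).sum_comp, Fintype.sum_prod_type]
    have e : ∀ (j : ι) (g : Fin m → ι),
        (K.filter fun i => ∀ b, (Fin.consEquiv fun _ => ι) (j, g) b ≠ i) =
          ((K.erase j).filter fun i => ∀ b, g b ≠ i) := by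
      intro j g
      ext i
      simp only [Finset.mem_filter, Finset.mem_erase, Fin.forall_fin_succ, Fin.consEquiv_apply,
        Fin.cons_zero, Fin.cons_succ]
      tauto
    -- Condition on the first ball: it removes its site from `K`.
    simp_rw [e, Fin.prod_univ_succ, Fin.consEquiv_apply, Fin.cons_zero, Fin.cons_succ, mul_assoc,
      ← Finset.mul_sum]
    calc _ ≤ ∑ j, p 0 j * (1 - (1 - v) * (1 - q) ^ m) ^ (K.erase j).card :=
          Finset.sum_le_sum fun j _ => mul_le_mul_of_nonneg_left
            (ih (fun b => p b.succ) (fun b => hp _) (fun b => h1 _) (K.erase j)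
              fun b i hi => hK _ _ (Finset.mem_of_mem_erase hi)) (hp _ _)
      _ ≤ _ := by
          refine (sum_weight_mul_pow_card_erase_le hq0 (by nlinarith) (by nlinarith) (h1 0) K
            (hK 0)).trans (le_of_eq ?_)
          congr 1
          ring

/-- Independent balls come in two kinds. Each ball `b` of the kind `L` is counted, unless it lands
at its own site `s b` or one of the other balls lands there. Given the positions of the other balls,
the counts are independent, which bounds the generating function of the total. -/
theorem sum_prod_mul_pow_card_vacated_le {β ι : Type*} [Fintype β] [DecidableEq β] [Fintype ι]
    [DecidableEq ι] {v r : ℝ} (hv0 : 0 ≤ v) (hv1 : v ≤ 1) (hr0 : 0 ≤ r) (hr1 : r ≤ 1)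
    {p : β → ι → ℝ} (hp : ∀ b j, 0 ≤ p b j) (h1 : ∀ b, ∑ j, p b j = 1) (s : β → ι)
    (L : Finset β) (hs : Set.InjOn s L) (hr : ∀ b ∈ L, r ≤ 1 - p b (s b)) :
    ∑ f : β → ι, (∏ b, p b (f b)) *
        v ^ (L.filter fun b => f b ≠ s b ∧ ∀ b' ∉ L, f b' ≠ s b).card ≤
      (1 - (1 - v) * r) ^ (L.card - Lᶜ.card) := by
  have hx0 : 0 ≤ 1 - (1 - v) * r := by nlinarith
  have hx1 : 1 - (1 - v) * r ≤ 1 := by nlinarith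
  rw [← (Equiv.piEquivPiSubtypeProd (· ∈ L) fun _ => ι).symm.sum_comp, Fintype.sum_prod_type_right]
  -- `h` gives the positions of the other balls, `g` those of the balls in `L`; given `h`, the
  -- summand is a product over the balls in `L`.
  have key : ∀ h : {b // b ∉ L} → ι, ∀ g : {b // b ∈ L} → ι,
      (∏ b, p b ((Equiv.piEquivPiSubtypeProd (· ∈ L) fun _ => ι).symm (g, h) b)) *
        v ^ (L.filter fun b => (Equiv.piEquivPiSubtypeProd (· ∈ L) fun _ => ι).symm (g, h) b ≠ s b ∧
          ∀ b' ∉ L, (Equiv.piEquivPiSubtypeProd (· ∈ L) fun _ => ι).symm (g, h) b' ≠ s b).card =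
      (∏ b, p b.1 (h b)) * ∏ b, p b.1 (g b) *
        (if g b ≠ s b.1 ∧ ∀ b', h b' ≠ s b.1 then v else 1) := by
    intro h g
    rw [Finset.prod_mul_distrib, ← mul_assoc]
    congr 1
    · rw [mul_comm, ← Fintype.prod_subtype_mul_prod_subtype (· ∈ L)]
      congr 1
      · refine Finset.prod_congr (by ext; simp) fun b _ => ?_
        simp [Equiv.piEquivPiSubtypeProd, b.2]
      · refine Finset.prod_congr rfl fun b _ => ?_
        simp [Equiv.piEquivPiSubtypeProd, b.2]
    · rw [Finset.card_filter, ← Finset.prod_pow_eq_pow_sum, ← Finset.prod_coe_sort]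
      refine Finset.prod_congr rfl fun b _ => ?_
      have e : (∀ b' ∉ L, (Equiv.piEquivPiSubtypeProd (· ∈ L) fun _ => ι).symm (g, h) b' ≠ s b) ↔
          ∀ b', h b' ≠ s b.1 := by
        constructor
        · intro H b'
          have := H b'.1 b'.2
          simpa [Equiv.piEquivPiSubtypeProd, b'.2] using this
        · intro H b' hb'
          simpa [Equiv.piEquivPiSubtypeProd, hb'] using H ⟨b', hb'⟩
      have e2 : (Equiv.piEquivPiSubtypeProd (· ∈ L) fun _ => ι).symm (g, h) b = g b := by
        simp [Equiv.piEquivPiSubtypeProd, b.2]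
      simp only [e, e2]
      split_ifs <;> simp
  simp_rw [key, ← Finset.mul_sum]
  have inner : ∀ h : {b // b ∉ L} → ι, ∑ g : {b // b ∈ L} → ι, ∏ b, p b.1 (g b) *
        (if g b ≠ s b.1 ∧ ∀ b', h b' ≠ s b.1 then v else 1) ≤
      (1 - (1 - v) * r) ^ (L.card - Lᶜ.card) := by
    intro h
    rw [← Fintype.piFinset_univ, ← Finset.prod_univ_sum (fun _ => Finset.univ)
      (fun (b : {b // b ∈ L}) j => p b.1 j *
        (if j ≠ s b.1 ∧ ∀ b', h b' ≠ s b.1 then v else 1))]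
    calc _ ≤ ∏ b : {b // b ∈ L}, (if ∀ b', h b' ≠ s b.1 then 1 - (1 - v) * r else 1) := by
          refine Finset.prod_le_prod (fun b _ => Finset.sum_nonneg fun j _ =>
            mul_nonneg (hp _ _) (by split_ifs <;> linarith)) fun b _ => ?_
          split_ifs with hb
          · have e : ∀ j, p b.1 j * (if j ≠ s b.1 ∧ ∀ b', h b' ≠ s b.1 then v else 1) =
                p b.1 j * v + if j = s b.1 then (1 - v) * p b.1 j else 0 := by
              intro j
              by_cases hj : j = s b.1
              · simp [hj]; ring
              · simp [hj]
                intro x hx hx'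
                exact absurd hx' (hb ⟨x, hx⟩)
            simp_rw [e]
            rw [Finset.sum_add_distrib, ← Finset.sum_mul, h1, Finset.sum_ite_eq' Finset.univ]
            simp only [Finset.mem_univ, if_true]
            nlinarith [hr b.1 b.2]
          · simp_rw [if_neg fun h => hb (And.right h), mul_one]
            exact (h1 _).le
      _ = (1 - (1 - v) * r) ^ (L.filter fun b => ∀ b', h b' ≠ s b).card := by
          rw [Finset.prod_coe_sort L fun b => if ∀ b', h b' ≠ s b then 1 - (1 - v) * r else 1,
            Finset.prod_ite, Finset.prod_const, Finset.prod_const_one, mul_one]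
      _ ≤ _ := by
          refine pow_le_pow_of_le_one hx0 hx1 ?_
          -- The other balls spoil at most as many sites as there are of them.
          have hsub : (L.filter fun b => ¬ ∀ b', h b' ≠ s b).card ≤ Lᶜ.card := by
            have hc : (L.filter fun b => ¬ ∀ b', h b' ≠ s b).card ≤
                (Finset.univ.image h).card := by
              refine Finset.card_le_card_of_injOn s ?_
                (hs.mono fun b hb => (Finset.mem_filter.1 hb).1)
              intro b hb
              have := (Finset.mem_filter.1 hb).2
              push Not at this
              obtain ⟨b', hb'⟩ := this
              exact Finset.mem_coe.2 (Finset.mem_image.2 ⟨b', Finset.mem_univ _, hb'⟩)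
            refine hc.trans (Finset.card_image_le.trans (le_of_eq ?_))
            rw [Finset.card_univ, Fintype.card_subtype]
            congr 1
            ext b
            simp
          have := Finset.card_filter_add_card_filter_not (s := L) (fun b => ∀ b', h b' ≠ s b)
          omega
  calc _ ≤ ∑ h : {b // b ∉ L} → ι, (∏ b, p b.1 (h b)) * (1 - (1 - v) * r) ^ (L.card - Lᶜ.card) :=
        Finset.sum_le_sum fun h _ => mul_le_mul_of_nonneg_left (inner h)
          (Finset.prod_nonneg fun b _ => hp _ _)
    _ = _ := by
        rw [← Finset.sum_mul, sum_prod_weight_eq_one (p := fun b : {b // b ∉ L} => p b.1)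
          (fun b => h1 _), one_mul]

/-- Markov's inequality for `u ^ (r * X)`. -/
theorem sum_filter_lt_mul_pow_le {Φ : Type*} [Fintype Φ] {w : Φ → ℝ} (hw : ∀ f, 0 ≤ w f)
    {u : ℝ} (hu0 : 0 ≤ u) (hu1 : u ≤ 1) (X : Φ → ℕ) (r t : ℕ) :
    (∑ f with r * X f < t, w f) * u ^ t ≤ ∑ f, w f * (u ^ r) ^ X f := by
  rw [Finset.sum_mul]
  calc _ ≤ ∑ f with r * X f < t, w f * (u ^ r) ^ X f := by
        refine Finset.sum_le_sum fun f hf => mul_le_mul_of_nonneg_left ?_ (hw f)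
        rw [← pow_mul]
        exact pow_le_pow_of_le_one hu0 hu1 (Finset.mem_filter.1 hf).2.le
    _ ≤ _ := Finset.sum_le_sum_of_subset_of_nonneg (Finset.filter_subset _ _)
        fun f _ _ => mul_nonneg (hw f) (by positivity)

/-! ### The law of one round -/

theorem taskStep_apply {n : ℕ} (x : Fin n → ℕ) (i l : Fin n) :
    taskStep x i l = ∑ j, (n : ℝ≥0∞)⁻¹ *
      ((if l = j then (moveProb x i j : ℝ≥0∞) else 0) +
        if l = i then ((1 - moveProb x i j : ℝ≥0) : ℝ≥0∞) else 0) := by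
  have : Nonempty (Fin n) := ⟨i⟩
  unfold taskStep
  rw [PMF.bind_apply, tsum_fintype]
  refine Finset.sum_congr rfl fun j _ => ?_
  rw [PMF.uniformOfFintype_apply, Fintype.card_fin, PMF.map_apply, tsum_fintype, Fintype.sum_bool]
  simp [coin]

/-- A task moves to any other resource `l` with probability `moveProb x i l / n`. -/
theorem taskStep_apply_of_ne {n : ℕ} (x : Fin n → ℕ) {i l : Fin n} (h : l ≠ i) :
    taskStep x i l = (n : ℝ≥0∞)⁻¹ * moveProb x i l := by
  rw [taskStep_apply]
  simp [h]

theorem inv_le_taskStep_self {n : ℕ} (x : Fin n → ℕ) (i : Fin n) :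
    (n : ℝ≥0∞)⁻¹ ≤ taskStep x i i := by
  rw [taskStep_apply]
  refine le_trans ?_ (Finset.single_le_sum (fun _ _ => zero_le) (Finset.mem_univ i))
  simp [moveProb]

theorem moveProb_of_eq_zero {n : ℕ} {x : Fin n → ℕ} {i j : Fin n} (hi : x i ≠ 0) (hj : x j = 0) :
    moveProb x i j = 1 := by
  simp [moveProb, hj, Nat.pos_of_ne_zero hi]

theorem load_self_ne_zero {m n : ℕ} (a : Allocation m n) (b : Fin m) : load a (a b) ≠ 0 :=
  Finset.card_ne_zero_of_mem (Finset.mem_filter.2 ⟨Finset.mem_univ b, rfl⟩)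

theorem load_eq_zero_iff {m n : ℕ} {a : Allocation m n} {i : Fin n} :
    load a i = 0 ↔ ∀ b, a b ≠ i := by
  simp [load, Finset.filter_eq_empty_iff]

theorem taskStep_of_load_eq_zero {m n : ℕ} {a : Allocation m n} (b : Fin m) {j : Fin n}
    (hj : load a j = 0) : taskStep (load a) (a b) j = (n : ℝ≥0∞)⁻¹ := by
  have hne : j ≠ a b := by
    rintro rfl
    exact load_self_ne_zero a b hj
  rw [taskStep_apply_of_ne _ hne,
    moveProb_of_eq_zero (load_self_ne_zero a b) hj, ENNReal.coe_one, mul_one]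

/-- A task that is alone on its resource can only move to an empty resource. -/
theorem eq_or_load_eq_zero_of_taskStep_ne_zero {m n : ℕ} {a : Allocation m n} {b : Fin m}
    {j : Fin n} (hb : load a (a b) = 1) (h : taskStep (load a) (a b) j ≠ 0) :
    j = a b ∨ load a j = 0 := by
  by_contra! hc
  refine h ?_
  rw [taskStep_apply_of_ne _ hc.1, moveProb, if_neg (by omega)]
  simp

theorem sum_load {m n : ℕ} (a : Allocation m n) : ∑ i, load a i = m := by
  have := Finset.card_eq_sum_card_fiberwise (f := a) (s := Finset.univ) (t := Finset.univ)
    (fun _ _ => Finset.mem_coe.2 (Finset.mem_univ _))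
  simpa [load] using this.symm

/-- With as many tasks as resources, no resource is empty at a Nash equilibrium. -/
theorem IsNash.numEmpty_eq_zero {n : ℕ} {a : Allocation n n} (h : IsNash (load a)) :
    numEmpty (load a) = 0 := by
  rw [numEmpty, Finset.card_eq_zero, Finset.filter_eq_empty_iff]
  intro i _ hi
  have hle : ∀ j, load a j ≤ 1 := by
    intro j
    have := h j i
    rw [hi, abs_le] at this
    have := this.2
    push_cast at this
    omega
  have : ∑ j, load a j < ∑ _j : Fin n, 1 :=
    Finset.sum_lt_sum (fun j _ => hle j) ⟨i, Finset.mem_univ i, by omega⟩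
  simp [sum_load] at this

theorem isNash_of_injective {n : ℕ} {a : Allocation n n} (h : Function.Injective a) :
    IsNash (load a) := by
  have hb := Finite.injective_iff_surjective.1 h
  have : ∀ i, load a i = 1 := by
    intro i
    obtain ⟨b, rfl⟩ := hb i
    rw [load, Finset.card_eq_one]
    refine ⟨b, ?_⟩
    ext b'
    simp [h.eq_iff]
  intro i j
  simp [this]

/-- The tasks can be spread evenly by moving only to empty resources. -/
theorem exists_perm_eq_or_load_eq_zero {n : ℕ} (a : Allocation n n) :
    ∃ e : Equiv.Perm (Fin n), ∀ b, e b = a b ∨ load a (e b) = 0 := by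
  classical
  -- One task stays on each occupied resource; the others are matched with the empty resources.
  choose g hg using fun i : Set.range a => i.2
  have hinj : Function.Injective g := fun i j hij => Subtype.ext (by rw [← hg i, ← hg j, hij])
  let e : {b // b ∈ Set.range g} ≃ {i // i ∈ Set.range a} := (Equiv.ofInjective g hinj).symm
  refine ⟨e.extendSubtype, fun b => ?_⟩
  by_cases hb : b ∈ Set.range g
  · left
    rw [e.extendSubtype_apply_of_mem _ hb]
    obtain ⟨i, rfl⟩ := hb
    have : e ⟨g i, ⟨i, rfl⟩⟩ = i := Equiv.ofInjective_symm_apply hinj i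
    rw [this, hg]
  · right
    have := e.extendSubtype_not_mem b hb
    rw [load_eq_zero_iff]
    exact fun b' hb' => this ⟨b', hb'⟩

theorem round_apply {m n : ℕ} (a a' : Allocation m n) :
    round a a' = ∏ b, taskStep (load a) (a b) (a' b) := rfl

/-- A single round leads to a Nash equilibrium with probability at least `n⁻ⁿ`. -/
theorem inv_pow_le_round_isNash {n : ℕ} (a : Allocation n n) :
    (n : ℝ≥0∞)⁻¹ ^ n ≤ (round a).toMeasure {a' | IsNash (load a')} := by
  obtain ⟨e, he⟩ := exists_perm_eq_or_load_eq_zero a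
  calc (n : ℝ≥0∞)⁻¹ ^ n = ∏ _b : Fin n, (n : ℝ≥0∞)⁻¹ := by simp
    _ ≤ round a e := by
        rw [round_apply]
        refine Finset.prod_le_prod' fun b _ => ?_
        rcases he b with h | h
        · rw [h]; exact inv_le_taskStep_self _ _
        · rw [taskStep_of_load_eq_zero b h]
    _ = (round a).toMeasure {⇑e} :=
        (PMF.toMeasure_apply_singleton _ _ (MeasurableSet.of_discrete)).symm
    _ ≤ _ := measure_mono (Set.singleton_subset_iff.2 (isNash_of_injective e.injective))

/-! ### The process and its hitting times -/

/-- The one-step bound `q` for entering `C` from `G` holds along the process, given any past that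
stays in `G`. -/
theorem IsProtocolProcess.measure_stay_and_mem_le {m n : ℕ} {Ω : Type*} [MeasurableSpace Ω]
    {P : Measure Ω} {A : ℕ → Ω → Allocation m n} (hA : IsProtocolProcess P A)
    (G C : Set (Allocation m n)) {q : ℝ≥0∞} (hq : ∀ a ∈ G, (round a).toMeasure C ≤ q) (t : ℕ) :
    P {ω | (∀ s ≤ t, A s ω ∈ G) ∧ A (t + 1) ω ∈ C} ≤ q * P {ω | ∀ s ≤ t, A s ω ∈ G} := by
  classical
  -- A history up to time `t` extends to a sequence that is constant from time `t` on.
  let ext : (Fin (t + 1) → Allocation m n) → ℕ → Allocation m n :=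
    fun h s => h ⟨min s t, by omega⟩
  let past : (Fin (t + 1) → Allocation m n) → Set Ω := fun h => {ω | ∀ s ≤ t, A s ω = ext h s}
  let H : Finset (Fin (t + 1) → Allocation m n) := Finset.univ.filter fun h => ∀ s, h s ∈ G
  have hext : ∀ (ω : Ω), ∀ s ≤ t, A s ω = ext (fun s => A s ω) s := by
    intro ω s hs
    simp only [ext, min_eq_left hs]
  have hmeas : ∀ h, MeasurableSet (past h) := by
    intro h
    have : past h = ⋂ s ∈ Finset.range (t + 1), A s ⁻¹' {ext h s} := by
      ext ω
      simp [past]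
    rw [this]
    exact Finset.measurableSet_biInter _ fun s _ => hA.measurable s (MeasurableSet.of_discrete)
  have hdisj : Set.PairwiseDisjoint (H : Set (Fin (t + 1) → Allocation m n)) past := by
    intro h _ h' _ hne
    refine Set.disjoint_left.2 fun ω h1 h2 => hne (funext fun s => ?_)
    have e := (h1 s (by omega)).symm.trans (h2 s (by omega))
    have e' : (⟨min (s : ℕ) t, by omega⟩ : Fin (t + 1)) = s := Fin.ext (min_eq_left (by omega))
    simpa only [ext, e'] using e
  have hG : {ω | ∀ s ≤ t, A s ω ∈ G} = ⋃ h ∈ H, past h := by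
    ext ω
    simp only [Set.mem_iUnion, exists_prop, H, Finset.mem_filter, Finset.mem_univ, true_and]
    constructor
    · intro h
      exact ⟨fun s => A s ω, fun s => h s (by omega), hext ω⟩
    · rintro ⟨h, hh, hω⟩ s hs
      rw [hω s hs]
      exact hh _
  have hstep : ∀ h ∈ H, P {ω | ω ∈ past h ∧ A (t + 1) ω ∈ C} ≤ P (past h) * q := by
    intro h hh
    have hGh : ext h t ∈ G := (Finset.mem_filter.1 hh).2 _
    calc P {ω | ω ∈ past h ∧ A (t + 1) ω ∈ C}
        ≤ P (⋃ c ∈ Finset.univ.filter (· ∈ C),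
            {ω | ∀ s ≤ t + 1, A s ω = (fun s => if s ≤ t then ext h s else c) s}) := by
          refine measure_mono fun ω hω => ?_
          simp only [Set.mem_iUnion, exists_prop, Finset.mem_filter, Finset.mem_univ, true_and]
          refine ⟨A (t + 1) ω, hω.2, fun s hs => ?_⟩
          by_cases h' : s ≤ t
          · simpa [h'] using hω.1 s h'
          · obtain rfl : s = t + 1 := by omega
            simp
      _ ≤ ∑ c ∈ Finset.univ.filter (· ∈ C),
            P {ω | ∀ s ≤ t + 1, A s ω = (fun s => if s ≤ t then ext h s else c) s} :=
          measure_biUnion_finset_le _ _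
      _ = ∑ c ∈ Finset.univ.filter (· ∈ C), P (past h) * round (ext h t) c := by
          refine Finset.sum_congr rfl fun c _ => ?_
          rw [hA.markov t]
          simp only [le_refl, if_true, Nat.not_succ_le_self, if_false]
          congr 2
          ext ω
          refine forall₂_congr fun s hs => ?_
          simp [hs]
      _ = P (past h) * (round (ext h t)).toMeasure C := by
          rw [← Finset.mul_sum, PMF.toMeasure_apply_fintype, Finset.sum_filter]
          simp [Set.indicator_apply]
      _ ≤ _ := by gcongr; exact hq _ hGh
  calc P {ω | (∀ s ≤ t, A s ω ∈ G) ∧ A (t + 1) ω ∈ C}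
      ≤ P (⋃ h ∈ H, {ω | ω ∈ past h ∧ A (t + 1) ω ∈ C}) := by
        refine measure_mono fun ω hω => ?_
        have : ω ∈ ⋃ h ∈ H, past h := hG ▸ hω.1
        simp only [Set.mem_iUnion, exists_prop] at this ⊢
        obtain ⟨h, hh, hωh⟩ := this
        exact ⟨h, hh, hωh, hω.2⟩
    _ ≤ ∑ h ∈ H, P {ω | ω ∈ past h ∧ A (t + 1) ω ∈ C} := measure_biUnion_finset_le _ _
    _ ≤ ∑ h ∈ H, P (past h) * q := Finset.sum_le_sum hstep
    _ = q * P {ω | ∀ s ≤ t, A s ω ∈ G} := by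
        rw [hG, measure_biUnion_finset hdisj fun h _ => hmeas h, ← Finset.sum_mul, mul_comm]

theorem IsProtocolProcess.measure_exists_not_mem_le {m n : ℕ} {Ω : Type*} [MeasurableSpace Ω]
    {P : Measure Ω} [IsProbabilityMeasure P] {A : ℕ → Ω → Allocation m n}
    (hA : IsProtocolProcess P A) (G : Set (Allocation m n)) {q : ℝ≥0∞}
    (hq : ∀ a ∈ G, (round a).toMeasure Gᶜ ≤ q) (h0 : ∀ᵐ ω ∂P, A 0 ω ∈ G) (t : ℕ) :
    P {ω | ∃ s ≤ t, A s ω ∉ G} ≤ t * q := by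
  induction t with
  | zero =>
    rw [Nat.cast_zero, zero_mul, nonpos_iff_eq_zero]
    exact measure_mono_null (fun ω => by simp) h0
  | succ t ih =>
    calc P {ω | ∃ s ≤ t + 1, A s ω ∉ G}
        ≤ P ({ω | ∃ s ≤ t, A s ω ∉ G} ∪ {ω | (∀ s ≤ t, A s ω ∈ G) ∧ A (t + 1) ω ∈ Gᶜ}) := by
          refine measure_mono fun ω hω => ?_
          obtain ⟨s, hs, hω⟩ := hω
          by_cases h : ∃ s ≤ t, A s ω ∉ G
          · exact Or.inl h
          · push Not at h
            refine Or.inr ⟨h, ?_⟩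
            rcases Nat.lt_or_eq_of_le hs with h' | rfl
            · exact absurd (h s (by omega)) hω
            · exact hω
      _ ≤ t * q + q * P {ω | ∀ s ≤ t, A s ω ∈ G} :=
          (measure_union_le _ _).trans (add_le_add ih (hA.measure_stay_and_mem_le G _ hq t))
      _ ≤ t * q + q * 1 := by gcongr; exact prob_le_one
      _ = _ := by push_cast; ring

theorem IsProtocolProcess.measure_forall_mem_le_pow {m n : ℕ} {Ω : Type*} [MeasurableSpace Ω]
    {P : Measure Ω} [IsProbabilityMeasure P] {A : ℕ → Ω → Allocation m n}
    (hA : IsProtocolProcess P A) (G : Set (Allocation m n)) {q : ℝ≥0∞}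
    (hq : ∀ a ∈ G, (round a).toMeasure G ≤ q) (t : ℕ) :
    P {ω | ∀ s ≤ t, A s ω ∈ G} ≤ q ^ t := by
  induction t with
  | zero => rw [pow_zero]; exact prob_le_one
  | succ t ih =>
    calc P {ω | ∀ s ≤ t + 1, A s ω ∈ G}
        ≤ P {ω | (∀ s ≤ t, A s ω ∈ G) ∧ A (t + 1) ω ∈ G} :=
          measure_mono fun ω hω => ⟨fun s hs => hω s (by omega), hω _ le_rfl⟩
      _ ≤ q * P {ω | ∀ s ≤ t, A s ω ∈ G} := hA.measure_stay_and_mem_le G G hq t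
      _ ≤ _ := by rw [pow_succ']; gcongr

/-- The tail-sum bound for the expectation of `nashTime`: `T` counts the times `t` before the first
Nash equilibrium. -/
theorem nashTime_le_tsum {m n : ℕ} {Ω : Type*} (A : ℕ → Ω → Allocation m n) (ω : Ω) :
    nashTime A ω ≤
      ∑' t : ℕ, {ω | ∀ s ≤ t, A s ω ∈ {a | ¬ IsNash (load a)}}.indicator (fun _ => (1 : ℝ≥0∞)) ω := by
  classical
  by_cases h : ∃ t, IsNash (load (A t ω))
  · refine (iInf₂_le (Nat.find h) (Nat.find_spec h)).trans ?_
    refine le_trans (le_of_eq ?_) (ENNReal.sum_le_tsum (Finset.range (Nat.find h)))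
    rw [Finset.sum_congr rfl (g := fun _ => (1 : ℝ≥0∞))]
    · simp
    · intro t ht
      refine Set.indicator_of_mem ?_ _
      exact fun s hs => Nat.find_min h (lt_of_le_of_lt hs (Finset.mem_range.1 ht))
  · push Not at h
    have : ∀ t : ℕ, {ω | ∀ s ≤ t, A s ω ∈ {a | ¬ IsNash (load a)}}.indicator
        (fun _ => (1 : ℝ≥0∞)) ω = 1 := fun t =>
      Set.indicator_of_mem (show ω ∈ {ω | ∀ s ≤ t, A s ω ∈ {a | ¬ IsNash (load a)}} from fun s _ => h s) _
    simp_rw [this]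
    rw [ENNReal.tsum_const_eq_top_of_ne_zero one_ne_zero]
    exact le_top

/-- From every allocation a Nash equilibrium is reached in one round with probability at least `n⁻ⁿ`,
so the time has a geometric tail. -/
theorem IsProtocolProcess.lintegral_nashTime_lt_top {n : ℕ} {Ω : Type*} [MeasurableSpace Ω]
    {P : Measure Ω} [IsProbabilityMeasure P] {A : ℕ → Ω → Allocation n n}
    (hA : IsProtocolProcess P A) : ∫⁻ ω, nashTime A ω ∂P < ∞ := by
  have hp0 : (n : ℝ≥0∞)⁻¹ ^ n ≠ 0 := pow_ne_zero _ (ENNReal.inv_ne_zero.2 (ENNReal.natCast_ne_top n))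
  have hq : ∀ a ∈ {a : Allocation n n | ¬ IsNash (load a)},
      (round a).toMeasure {a | ¬ IsNash (load a)} ≤ 1 - (n : ℝ≥0∞)⁻¹ ^ n := by
    intro a _
    have h := prob_compl_eq_one_sub (μ := (round a).toMeasure)
      (MeasurableSet.of_discrete (s := {a' : Allocation n n | IsNash (load a')}))
    rw [Set.compl_ofPred] at h
    rw [h]
    exact tsub_le_tsub_left (inv_pow_le_round_isNash a) 1
  have hmeas : ∀ t : ℕ, MeasurableSet {ω | ∀ s ≤ t, A s ω ∈ {a | ¬ IsNash (load a)}} := by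
    intro t
    have : {ω | ∀ s ≤ t, A s ω ∈ {a | ¬ IsNash (load a)}} =
        ⋂ s ∈ Finset.range (t + 1), A s ⁻¹' {a | ¬ IsNash (load a)} := by
      ext ω
      simp
    rw [this]
    exact Finset.measurableSet_biInter _ fun s _ => hA.measurable s (MeasurableSet.of_discrete)
  calc ∫⁻ ω, nashTime A ω ∂P
      ≤ ∫⁻ ω, ∑' t : ℕ, {ω | ∀ s ≤ t, A s ω ∈ {a | ¬ IsNash (load a)}}.indicator
          (fun _ => (1 : ℝ≥0∞)) ω ∂P := lintegral_mono fun ω => nashTime_le_tsum A ω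
    _ = ∑' t : ℕ, P {ω | ∀ s ≤ t, A s ω ∈ {a | ¬ IsNash (load a)}} := by
        rw [lintegral_tsum fun t => (measurable_const.indicator (hmeas t)).aemeasurable]
        refine tsum_congr fun t => ?_
        rw [lintegral_indicator_const (hmeas t), one_mul]
    _ ≤ ∑' t : ℕ, (1 - (n : ℝ≥0∞)⁻¹ ^ n) ^ t :=
        ENNReal.tsum_le_tsum fun t => hA.measure_forall_mem_le_pow _ hq t
    _ = (1 - (1 - (n : ℝ≥0∞)⁻¹ ^ n))⁻¹ := ENNReal.tsum_geometric _
    _ < ∞ := by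
        rw [ENNReal.inv_lt_top, tsub_pos_iff_lt]
        exact ENNReal.sub_lt_self ENNReal.one_ne_top one_ne_zero hp0

/-- If every round leaves the set `G`, which contains no Nash equilibrium, with probability at most
`q`, then by a union bound no Nash equilibrium is reached within `t` rounds, except with probability
`t * q`. The subtraction in `ℝ≥0∞` is truncated, so the bound is void for `t * q ≥ 1`. -/
theorem IsProtocolProcess.le_lintegral_nashTime {m n : ℕ} {Ω : Type*} [MeasurableSpace Ω]
    {P : Measure Ω} [IsProbabilityMeasure P] {A : ℕ → Ω → Allocation m n}
    (hA : IsProtocolProcess P A) (G : Set (Allocation m n)) (hG : ∀ a ∈ G, ¬ IsNash (load a))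
    {q : ℝ≥0∞} (hq : ∀ a ∈ G, (round a).toMeasure Gᶜ ≤ q) (h0 : ∀ᵐ ω ∂P, A 0 ω ∈ G) (t : ℕ) :
    t * (1 - t * q) ≤ ∫⁻ ω, nashTime A ω ∂P := by
  have hmeas : MeasurableSet {ω | ∃ s ≤ t, A s ω ∉ G} := by
    have : {ω | ∃ s ≤ t, A s ω ∉ G} = ⋃ s ∈ Finset.range (t + 1), A s ⁻¹' Gᶜ := by
      ext ω
      simp
    rw [this]
    exact Finset.measurableSet_biUnion _ fun s _ => hA.measurable s (MeasurableSet.of_discrete)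
  calc (t : ℝ≥0∞) * (1 - t * q) ≤ t * (1 - P {ω | ∃ s ≤ t, A s ω ∉ G}) := by
        gcongr
        exact hA.measure_exists_not_mem_le G hq h0 t
    _ = t * P {ω | ∃ s ≤ t, A s ω ∉ G}ᶜ := by rw [prob_compl_eq_one_sub hmeas]
    _ = ∫⁻ ω, {ω | ∃ s ≤ t, A s ω ∉ G}ᶜ.indicator (fun _ => (t : ℝ≥0∞)) ω ∂P :=
        (lintegral_indicator_const hmeas.compl _).symm
    _ ≤ _ := by
        refine lintegral_mono fun ω => ?_
        refine Set.indicator_le (fun ω hω => ?_) ω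
        refine le_iInf₂ fun s hs => ?_
        have : ¬ ∃ s ≤ t, A s ω ∉ G := hω
        push Not at this
        by_contra! hlt
        exact hG _ (this s (Nat.cast_lt.1 hlt).le) hs

/-! ### The number of empty resources after one round -/

/-- The tasks that are alone on their resource. -/
def singleTasks {m n : ℕ} (a : Allocation m n) : Finset (Fin m) :=
  Finset.univ.filter fun b => load a (a b) = 1

/-- The number of resources that are empty under `a` and also under `f`. -/
def numStayEmpty {m n : ℕ} (a f : Allocation m n) : ℕ :=
  ((Finset.univ.filter fun j => load a j = 0).filter fun j => ∀ b, f b ≠ j).card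

/-- The number of resources with a single task under `a` such that, in going from `a` to `f`, this
task leaves and no task from a resource of load different from `1` arrives. -/
def numVacated {m n : ℕ} (a f : Allocation m n) : ℕ :=
  ((singleTasks a).filter fun b => f b ≠ a b ∧ ∀ b' ∉ singleTasks a, f b' ≠ a b).card

theorem injOn_singleTasks {m n : ℕ} (a : Allocation m n) : Set.InjOn a (singleTasks a) := by
  intro b hb b' _ h
  have hb1 : load a (a b) = 1 := (Finset.mem_filter.1 hb).2
  exact Finset.card_le_one.1 hb1.le b (by simp) b' (by simp [h])

/-- After a round, the resources counted by `numVacated` are empty, since tasks that are alone on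
their resource only move to resources that were empty. -/
theorem numStayEmpty_add_numVacated_le {m n : ℕ} {a f : Allocation m n} (h : round a f ≠ 0) :
    numStayEmpty a f + numVacated a f ≤ numEmpty (load f) := by
  classical
  rw [round_apply, Finset.prod_ne_zero_iff] at h
  rw [numStayEmpty, numVacated, numEmpty, ← Finset.card_image_of_injOn
    ((injOn_singleTasks a).mono fun b hb => (Finset.mem_filter.1 hb).1), ← Finset.card_union_of_disjoint]
  · refine Finset.card_le_card fun j hj => ?_
    rw [Finset.mem_filter, load_eq_zero_iff]
    refine ⟨Finset.mem_univ _, ?_⟩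
    rcases Finset.mem_union.1 hj with hj | hj
    · exact (Finset.mem_filter.1 hj).2
    · obtain ⟨b, hb, rfl⟩ := Finset.mem_image.1 hj
      obtain ⟨hbL, hne, hall⟩ := Finset.mem_filter.1 hb
      intro b' hb'
      by_cases hL : b' ∈ singleTasks a
      · rcases eq_or_load_eq_zero_of_taskStep_ne_zero (Finset.mem_filter.1 hL).2
          (h b' (Finset.mem_univ _)) with h1 | h1
        · have := injOn_singleTasks a hbL hL (hb'.symm.trans h1)
          subst this
          exact hne hb'
        · rw [hb'] at h1
          exact load_self_ne_zero a b h1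
      · exact hall b' hL hb'
  · refine Finset.disjoint_left.2 fun j hj hj' => ?_
    obtain ⟨b, _, rfl⟩ := Finset.mem_image.1 hj'
    exact load_self_ne_zero a b (Finset.mem_filter.1 (Finset.mem_filter.1 hj).1).2

/-- If few resources are empty, almost all tasks are alone on their resource. -/
theorem le_card_singleTasks_add {n : ℕ} (a : Allocation n n) :
    n ≤ (singleTasks a).card + 2 * numEmpty (load a) := by
  classical
  have h1 : (Finset.univ.filter fun i => load a i = 1).card ≤ (singleTasks a).card := by
    refine Finset.card_le_card_of_surjOn a fun i hi => ?_
    have hi1 : load a i = 1 := (Finset.mem_filter.1 hi).2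
    have : ¬ ∀ b, a b ≠ i := fun h => by
      rw [load_eq_zero_iff.2 h] at hi1
      omega
    push Not at this
    obtain ⟨b, rfl⟩ := this
    exact ⟨b, Finset.mem_coe.2 (Finset.mem_filter.2 ⟨Finset.mem_univ _, hi1⟩), rfl⟩
  have h2 : ∑ _i : Fin n, 2 ≤
      ∑ i, (load a i + 2 * (if load a i = 0 then 1 else 0) + if load a i = 1 then 1 else 0) := by
    refine Finset.sum_le_sum fun i _ => ?_
    split_ifs <;> omega
  rw [Finset.sum_add_distrib, Finset.sum_add_distrib, sum_load, ← Finset.mul_sum,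
    ← Finset.card_filter, ← Finset.card_filter] at h2
  simp only [Finset.sum_const, Finset.card_univ, Fintype.card_fin, smul_eq_mul] at h2
  unfold numEmpty
  omega

/-- The law of a task after one round, as real numbers. -/
noncomputable def taskWeight {m n : ℕ} (a : Allocation m n) (b : Fin m) (j : Fin n) : ℝ :=
  (taskStep (load a) (a b) j).toReal

theorem taskWeight_nonneg {m n : ℕ} (a : Allocation m n) (b : Fin m) (j : Fin n) :
    0 ≤ taskWeight a b j := ENNReal.toReal_nonneg

theorem sum_taskWeight {m n : ℕ} (a : Allocation m n) (b : Fin m) :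
    ∑ j, taskWeight a b j = 1 := by
  have h := (taskStep (load a) (a b)).tsum_coe
  rw [tsum_fintype] at h
  unfold taskWeight
  rw [← ENNReal.toReal_sum fun j _ => PMF.apply_ne_top _ j, h, ENNReal.toReal_one]

theorem taskWeight_of_load_eq_zero {m n : ℕ} {a : Allocation m n} (b : Fin m) {j : Fin n}
    (hj : load a j = 0) : taskWeight a b j = (n : ℝ)⁻¹ := by
  simp [taskWeight, taskStep_of_load_eq_zero b hj]

/-- Every task leaves its resource with probability at least the proportion of empty resources. -/
theorem numEmpty_div_le_one_sub_taskWeight {m n : ℕ} (a : Allocation m n) (b : Fin m) :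
    (numEmpty (load a) : ℝ) / n ≤ 1 - taskWeight a b (a b) := by
  rw [← sum_taskWeight a b, ← Finset.sum_erase_eq_sub (Finset.mem_univ (a b))]
  calc (numEmpty (load a) : ℝ) / n
      = ∑ j ∈ Finset.univ.filter (fun j => load a j = 0), taskWeight a b j := by
        rw [Finset.sum_congr rfl fun j hj =>
          taskWeight_of_load_eq_zero b (Finset.mem_filter.1 hj).2, Finset.sum_const, nsmul_eq_mul]
        rfl
    _ ≤ _ := by
        refine Finset.sum_le_sum_of_subset_of_nonneg (fun j hj => ?_)
          fun j _ _ => taskWeight_nonneg a b j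
        refine Finset.mem_erase.2 ⟨?_, Finset.mem_univ _⟩
        rintro rfl
        exact load_self_ne_zero a b (Finset.mem_filter.1 hj).2

theorem round_apply_eq_ofReal {m n : ℕ} (a f : Allocation m n) :
    round a f = ENNReal.ofReal (∏ b, taskWeight a b (f b)) := by
  rw [ENNReal.ofReal_prod_of_nonneg fun b _ => taskWeight_nonneg a b _, round_apply]
  exact Finset.prod_congr rfl fun b _ => (ENNReal.ofReal_toReal (PMF.apply_ne_top _ _)).symm

theorem prod_taskWeight_nonneg {m n : ℕ} (a f : Allocation m n) :
    0 ≤ ∏ b, taskWeight a b (f b) :=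
  Finset.prod_nonneg fun b _ => taskWeight_nonneg a b _

theorem one_quarter_le_one_sub_inv_pow {n : ℕ} (hn : 11 ≤ n) :
    (1 / 4 : ℝ) ≤ (1 - (n : ℝ)⁻¹) ^ n := by
  have hn' : (11 : ℝ) ≤ n := by exact_mod_cast hn
  -- `1 - 1 / n = 1 / (1 + 1 / (n - 1)) ≥ exp (- 1 / (n - 1))`
  have h1 : Real.exp (-(1 / ((n : ℝ) - 1))) ≤ 1 - (n : ℝ)⁻¹ := by
    have h := Real.add_one_le_exp (1 / ((n : ℝ) - 1))
    have e : 1 / ((n : ℝ) - 1) + 1 = (1 - (n : ℝ)⁻¹)⁻¹ := by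
      have : (n : ℝ) - 1 ≠ 0 := by linarith
      field_simp
      ring
    have hpos : 0 < 1 - (n : ℝ)⁻¹ := by
      have : (n : ℝ)⁻¹ < 1 := inv_lt_one_of_one_lt₀ (by linarith)
      linarith
    rw [e] at h
    rw [Real.exp_neg]
    exact inv_le_of_inv_le₀ hpos h
  calc (1 / 4 : ℝ) ≤ Real.exp (-(11 / 10)) := by
        have h2 : Real.exp (11 / 10) ≤ 4 := by
          have e : Real.exp (11 / 10) = Real.exp 1 * Real.exp (1 / 10) := by
            rw [← Real.exp_add]; norm_num
          have h3 : Real.exp (1 / 10) ≤ 10 / 9 := by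
            have := Real.one_sub_le_exp_neg (1 / 10)
            rw [Real.exp_neg] at this
            have h4 := inv_anti₀ (by norm_num) this
            rw [inv_inv] at h4
            refine h4.trans (by norm_num)
          have h5 := Real.exp_one_lt_d9
          rw [e]
          nlinarith [Real.exp_pos 1, Real.exp_pos (1 / 10)]
        rw [Real.exp_neg, one_div]
        exact inv_anti₀ (Real.exp_pos _) h2
    _ ≤ Real.exp (-(1 / ((n : ℝ) - 1))) ^ n := by
        rw [← Real.exp_nat_mul]
        refine Real.exp_le_exp.2 ?_
        have : (n : ℝ) * (1 / (n - 1)) ≤ 11 / 10 := by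
          rw [mul_one_div, div_le_div_iff₀ (by linarith) (by norm_num)]
          linarith
        linarith
    _ ≤ _ := pow_le_pow_left₀ (Real.exp_pos _).le h1 n

/-- An empty resource stays empty with probability about `1 / e`, so with high probability at least
an eighth of the empty resources stay empty. -/
theorem sum_numStayEmpty_lt_le {n : ℕ} (hn : 11 ≤ n) (a : Allocation n n) :
    ∑ f with 8 * numStayEmpty a f < numEmpty (load a), ∏ b, taskWeight a b (f b) ≤
      Real.exp (-(0.005 * (numEmpty (load a) : ℝ))) := by
  set k := numEmpty (load a) with hk
  have hn0 : (n : ℝ)⁻¹ ≤ 1 := inv_le_one_of_one_le₀ (by exact_mod_cast (by omega : 1 ≤ n))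
  have h1 := sum_filter_lt_mul_pow_le (prod_taskWeight_nonneg a) (u := 9 / 10) (by norm_num)
    (by norm_num) (numStayEmpty a) 8 k
  have h2 := sum_prod_mul_pow_card_unhit_le (q := (n : ℝ)⁻¹) (v := (9 / 10) ^ 8) (by positivity) hn0
    (by norm_num) (by norm_num) n (taskWeight a) (taskWeight_nonneg a) (sum_taskWeight a)
    (Finset.univ.filter fun j => load a j = 0)
    fun b j hj => (taskWeight_of_load_eq_zero b (Finset.mem_filter.1 hj).2).le
  have hq := one_quarter_le_one_sub_inv_pow hn
  have hq1 : (1 - (n : ℝ)⁻¹) ^ n ≤ 1 := pow_le_one₀ (by linarith) (by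
    have : 0 ≤ (n : ℝ)⁻¹ := by positivity
    linarith)
  -- The eighth power `v = (9 / 10) ^ 8` matches the threshold `k / 8`; the base is
  -- `(1 - (1 - v) / 4) / (9 / 10) < 0.96`.
  have h3 : (1 - (1 - (9 / 10 : ℝ) ^ 8) * (1 - (n : ℝ)⁻¹) ^ n) ^ k ≤
      (Real.exp (-0.005) * (9 / 10)) ^ k := by
    have h4 := Real.one_sub_le_exp_neg 0.005
    refine pow_le_pow_left₀ ?_ ?_ k
    · norm_num; linarith
    · norm_num at h4 ⊢; linarith
  have h5 := h1.trans (h2.trans h3)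
  rw [mul_pow, ← Real.exp_nat_mul] at h5
  have h6 := le_of_mul_le_mul_right h5 (by positivity)
  refine h6.trans (le_of_eq ?_)
  congr 1
  ring

/-- The numerical estimate behind `sum_numVacated_lt_le`: the generating function of a binomial
variable of mean close to `k`, at `(98 / 100) ^ 8`, against the threshold `7 k / 8`. -/
theorem one_sub_mul_div_pow_le {n k d : ℕ} (hn : 0 < n) (hk : k ≤ n)
    (hd : (99 / 100 : ℝ) * n ≤ d) :
    (1 - (1 - (98 / 100 : ℝ) ^ 8) * (k / n)) ^ d ≤ (Real.exp (-0.005) * (98 / 100) ^ 7) ^ k := by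
  have hn' : (0 : ℝ) < n := by exact_mod_cast hn
  have hk0 : (0 : ℝ) ≤ k := Nat.cast_nonneg k
  have hr1 : (k : ℝ) / n ≤ 1 := by
    rw [div_le_one hn']
    exact_mod_cast hk
  have h3 : (1 - (1 - (98 / 100 : ℝ) ^ 8) * (k / n)) ^ d ≤ Real.exp (-0.1475) ^ k := by
    calc (1 - (1 - (98 / 100 : ℝ) ^ 8) * (k / n)) ^ d
        ≤ Real.exp (-((1 - (98 / 100 : ℝ) ^ 8) * (k / n))) ^ d := by
          refine pow_le_pow_left₀ ?_ (Real.one_sub_le_exp_neg _) d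
          have : (0 : ℝ) ≤ k / n := by positivity
          norm_num
          linarith
      _ ≤ _ := by
          rw [← Real.exp_nat_mul, ← Real.exp_nat_mul]
          refine Real.exp_le_exp.2 ?_
          have : (99 / 100 : ℝ) * k ≤ d * (k / n) := by
            calc (99 / 100 : ℝ) * k = 99 / 100 * n * (k / n) := by field_simp
              _ ≤ _ := by gcongr
          norm_num
          linarith
  have h4 : Real.exp (-0.1475) ≤ Real.exp (-0.005) * (98 / 100) ^ 7 := by
    have h5 : Real.exp (-0.1425) ≤ (98 / 100) ^ 7 := by
      rw [Real.exp_neg]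
      refine inv_le_of_inv_le₀ (by norm_num) ?_
      refine le_trans ?_ (Real.quadratic_le_exp_of_nonneg (by norm_num))
      norm_num
    calc Real.exp (-0.1475) = Real.exp (-0.005) * Real.exp (-0.1425) := by
          rw [← Real.exp_add]; norm_num
      _ ≤ _ := by gcongr
  exact h3.trans (pow_le_pow_left₀ (Real.exp_pos _).le h4 k)

/-- If there are few empty resources, then nearly as many single tasks move to them, and with high
probability the resource of most of these tasks becomes empty. -/
theorem sum_numVacated_lt_le {n : ℕ} (hn : 0 < n) (a : Allocation n n)
    (hk : 400 * numEmpty (load a) ≤ n) :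
    ∑ f with 8 * numVacated a f < 7 * numEmpty (load a), ∏ b, taskWeight a b (f b) ≤
      Real.exp (-(0.005 * (numEmpty (load a) : ℝ))) := by
  set k := numEmpty (load a) with hkdef
  have hn' : (0 : ℝ) < n := by exact_mod_cast hn
  have hk' : (400 : ℝ) * k ≤ n := by exact_mod_cast hk
  have hk0 : (0 : ℝ) ≤ k := Nat.cast_nonneg k
  have hr1 : (k : ℝ) / n ≤ 1 := by
    rw [div_le_one hn']
    linarith
  have h1 := sum_filter_lt_mul_pow_le (prod_taskWeight_nonneg a) (u := 98 / 100) (by norm_num)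
    (by norm_num) (numVacated a) 8 (7 * k)
  have h2 : ∑ f, (∏ b, taskWeight a b (f b)) * ((98 / 100) ^ 8) ^ numVacated a f ≤
      (1 - (1 - (98 / 100) ^ 8) * ((k : ℝ) / n)) ^
        ((singleTasks a).card - (singleTasks a)ᶜ.card) := by
    convert sum_prod_mul_pow_card_vacated_le (v := (98 / 100) ^ 8) (r := (k : ℝ) / n) (by norm_num)
      (by norm_num) (by positivity) hr1 (taskWeight_nonneg a) (sum_taskWeight a) a
      (singleTasks a) (injOn_singleTasks a) fun b _ => numEmpty_div_le_one_sub_taskWeight a b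
    unfold numVacated
    congr!
  have hcard : n ≤ ((singleTasks a).card - (singleTasks a)ᶜ.card) + 4 * k := by
    have h := le_card_singleTasks_add a
    have h' := Finset.card_add_card_compl (singleTasks a)
    rw [Fintype.card_fin] at h'
    omega
  set d := (singleTasks a).card - (singleTasks a)ᶜ.card
  have hd : (99 / 100 : ℝ) * n ≤ d := by
    have : (n : ℝ) ≤ d + 4 * k := by exact_mod_cast hcard
    linarith
  have h6 := h1.trans (h2.trans (one_sub_mul_div_pow_le hn (by omega) hd))
  rw [mul_pow, ← pow_mul, ← Real.exp_nat_mul] at h6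
  have h7 := le_of_mul_le_mul_right h6 (by positivity)
  refine h7.trans (le_of_eq ?_)
  congr 1
  ring

/-- Starting from at least `⌊√n⌋` empty resources, a round leaves fewer than that with exponentially
small probability. -/
theorem round_numEmpty_lt_sqrt_le {n : ℕ} (hn : 10 ^ 8 ≤ n) (a : Allocation n n)
    (ha : Nat.sqrt n ≤ numEmpty (load a)) :
    (round a).toMeasure {a' | numEmpty (load a') < Nat.sqrt n} ≤
      ENNReal.ofReal (Real.exp (-(0.004 * √(n : ℝ)))) := by
  classical
  set k := numEmpty (load a) with hk
  set s := Nat.sqrt n with hs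
  have hs4 : 10 ^ 4 ≤ s := Nat.le_sqrt.2 (by omega)
  have hss : s * s ≤ n := Nat.sqrt_le n
  have hZ := sum_numStayEmpty_lt_le (by omega : 11 ≤ n) a
  rw [← hk] at hZ
  have e : (round a).toMeasure {a' | numEmpty (load a') < s} =
      ENNReal.ofReal (∑ f with numEmpty (load f) < s, ∏ b, taskWeight a b (f b)) := by
    rw [PMF.toMeasure_apply_fintype, ENNReal.ofReal_sum_of_nonneg
      fun f _ => prod_taskWeight_nonneg a f, Finset.sum_filter]
    refine Finset.sum_congr rfl fun f _ => ?_
    rw [← round_apply_eq_ofReal, Set.indicator_apply]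
    rfl
  rw [e]
  refine ENNReal.ofReal_le_ofReal ?_
  have hsum : ∑ f with numEmpty (load f) < s, ∏ b, taskWeight a b (f b) ≤
      2 * Real.exp (-(0.005 * (k : ℝ))) := by
    have hsupp : ∀ f, ∏ b, taskWeight a b (f b) ≠ 0 →
        numStayEmpty a f + numVacated a f ≤ numEmpty (load f) := by
      intro f hf
      refine numStayEmpty_add_numVacated_le ?_
      rw [round_apply_eq_ofReal, Ne, ENNReal.ofReal_eq_zero, not_le]
      exact lt_of_le_of_ne (prod_taskWeight_nonneg a f) hf.symm
    by_cases hks : 8 * s ≤ k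
    · -- The resources that stay empty suffice.
      have : ∑ f with numEmpty (load f) < s, ∏ b, taskWeight a b (f b) ≤
          ∑ f with 8 * numStayEmpty a f < k, ∏ b, taskWeight a b (f b) := by
        rw [← Finset.sum_filter_ne_zero]
        refine Finset.sum_le_sum_of_subset_of_nonneg (fun f hf => ?_)
          fun f _ _ => prod_taskWeight_nonneg a f
        simp only [Finset.mem_filter, Finset.mem_univ, true_and] at hf ⊢
        have := hsupp f hf.2
        omega
      linarith [Real.exp_pos (-(0.005 * (k : ℝ)))]
    · have hN := sum_numVacated_lt_le (by omega : 0 < n) a (by nlinarith)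
      rw [← hk] at hN
      have : ∑ f with numEmpty (load f) < s, ∏ b, taskWeight a b (f b) ≤
          ∑ f with 8 * numStayEmpty a f < k, ∏ b, taskWeight a b (f b) +
          ∑ f with 8 * numVacated a f < 7 * k, ∏ b, taskWeight a b (f b) := by
        rw [← Finset.sum_filter_ne_zero, ← Finset.sum_union_inter]
        refine le_trans (Finset.sum_le_sum_of_subset_of_nonneg (fun f hf => ?_)
          fun f _ _ => prod_taskWeight_nonneg a f)
          (le_add_of_nonneg_right (Finset.sum_nonneg fun f _ => prod_taskWeight_nonneg a f))
        simp only [Finset.mem_filter, Finset.mem_univ, true_and, Finset.mem_union] at hf ⊢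
        have := hsupp f hf.2
        omega
      linarith
  have hsq : √(n : ℝ) ≤ s + 1 := Real.real_sqrt_lt_nat_sqrt_succ.le
  have hsq4 : (10 ^ 4 : ℝ) ≤ √(n : ℝ) := Real.le_sqrt_of_sq_le (by
    have : ((10 ^ 8 : ℕ) : ℝ) ≤ n := by exact_mod_cast hn
    refine le_trans ?_ this
    norm_num)
  have hsk : (s : ℝ) ≤ k := by exact_mod_cast ha
  calc _ ≤ 2 * Real.exp (-(0.005 * (k : ℝ))) := hsum
    _ ≤ Real.exp 1 * Real.exp (-(0.005 * (k : ℝ))) := by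
        gcongr
        linarith [Real.add_one_le_exp 1]
    _ = Real.exp (1 + -(0.005 * (k : ℝ))) := (Real.exp_add _ _).symm
    _ ≤ _ := Real.exp_le_exp.2 (by norm_num at hsq4 ⊢; linarith)

/-! ### The lower bound for the expected time -/

theorem numEmpty_allOnFirst {n : ℕ} : n ≤ numEmpty (allOnFirst n n) + 1 := by
  have h := Finset.card_filter_add_card_filter_not (s := (Finset.univ : Finset (Fin n)))
    (fun i => allOnFirst n n i = 0)
  have h1 : (Finset.univ.filter fun i : Fin n => ¬ allOnFirst n n i = 0).card ≤ 1 := by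
    refine Finset.card_le_one.2 fun i hi j hj => ?_
    simp only [Finset.mem_filter, allOnFirst, ite_eq_right_iff, Finset.mem_univ, true_and,
      Classical.not_imp] at hi hj
    exact Fin.ext (hi.1.trans hj.1.symm)
  rw [Finset.card_univ, Fintype.card_fin] at h
  unfold numEmpty
  omega

theorem exp_le_lintegral_nashTime {n : ℕ} (hn : 10 ^ 8 ≤ n) {Ω : Type*} [MeasurableSpace Ω]
    {P : Measure Ω} [IsProbabilityMeasure P] {A : ℕ → Ω → Allocation n n}
    (hA : IsProtocolProcess P A) (h0 : ∀ᵐ ω ∂P, load (A 0 ω) = allOnFirst n n) :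
    ENNReal.ofReal (Real.exp (0.002 * √(n : ℝ))) ≤ ∫⁻ ω, nashTime A ω ∂P := by
  have hs4 : 10 ^ 4 ≤ Nat.sqrt n := Nat.le_sqrt.2 (by omega)
  have hss : Nat.sqrt n * Nat.sqrt n ≤ n := Nat.sqrt_le n
  have hsq4 : (10 ^ 4 : ℝ) ≤ √(n : ℝ) := Real.le_sqrt_of_sq_le (by
    have : ((10 ^ 8 : ℕ) : ℝ) ≤ n := by exact_mod_cast hn
    refine le_trans ?_ this
    norm_num)
  set x := Real.exp (0.002 * √(n : ℝ)) with hx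
  -- In `t ≈ 2 x` rounds the probability `x⁻²` per round accumulates to at most `1 / 2`.
  set t := ⌈2 * x⌉₊ with ht
  have hx6 : 6 ≤ x := by
    have := Real.add_one_le_exp (0.002 * √(n : ℝ))
    norm_num at this hsq4
    rw [hx]
    norm_num
    linarith
  have hqx : Real.exp (-(0.004 * √(n : ℝ))) = (x * x)⁻¹ := by
    rw [hx, ← Real.exp_add, ← Real.exp_neg]
    congr 1
    ring
  have hG : ∀ a ∈ {a : Allocation n n | Nat.sqrt n ≤ numEmpty (load a)},
      (round a).toMeasure {a : Allocation n n | Nat.sqrt n ≤ numEmpty (load a)}ᶜ ≤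
        ENNReal.ofReal (x * x)⁻¹ := by
    intro a ha
    have h := round_numEmpty_lt_sqrt_le hn a ha
    rw [hqx] at h
    refine le_trans (le_of_eq ?_) h
    congr 1
    ext a'
    simp
  have key := hA.le_lintegral_nashTime _ (fun a ha hN => by
    have ha' : Nat.sqrt n ≤ numEmpty (load a) := ha
    rw [hN.numEmpty_eq_zero] at ha'
    omega) hG (h0.mono fun ω hω => by
      have := numEmpty_allOnFirst (n := n)
      rw [Set.mem_ofPred_eq, hω]
      nlinarith) t
  refine le_trans ?_ key
  have ht1 : 2 * x ≤ t := Nat.le_ceil _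
  have ht2 : (t : ℝ) ≤ 3 * x := by
    have := Nat.ceil_lt_add_one (by positivity : 0 ≤ 2 * x)
    linarith
  have htq : t * (x * x)⁻¹ ≤ 1 / 2 := by
    rw [← div_eq_mul_inv, div_le_iff₀ (by positivity)]
    nlinarith
  have h1 : (1 : ℝ) / 2 ≤ 1 - t * (x * x)⁻¹ := by linarith
  calc ENNReal.ofReal x ≤ ENNReal.ofReal (t * (1 - t * (x * x)⁻¹)) := by
        refine ENNReal.ofReal_le_ofReal ?_
        nlinarith
    _ = t * (1 - t * ENNReal.ofReal (x * x)⁻¹) := by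
        rw [ENNReal.ofReal_mul (Nat.cast_nonneg _), ENNReal.ofReal_sub _ (by positivity),
          ENNReal.ofReal_mul (Nat.cast_nonneg _), ENNReal.ofReal_natCast, ENNReal.ofReal_one]

end LoadBalancing

theorem mainTheorem4 :
    (∃ c : ℝ, 0 < c ∧ ∃ N : ℕ, ∀ n : ℕ, N ≤ n →
      (∀ (Ω : Type*) [MeasurableSpace Ω] (P : Measure Ω) [IsProbabilityMeasure P]
          (A : ℕ → Ω → LoadBalancing.Allocation n n),
          LoadBalancing.IsProtocolProcess P A →
          (∀ᵐ ω ∂P, LoadBalancing.load (A 0 ω) = LoadBalancing.allOnFirst n n) →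
          ENNReal.ofReal (Real.exp (c * √(n : ℝ))) ≤ ∫⁻ ω, LoadBalancing.nashTime A ω ∂P ∧
          ∫⁻ ω, LoadBalancing.nashTime A ω ∂P < ∞) ∧
      (∀ a : LoadBalancing.Allocation n n,
          Nat.sqrt n ≤ LoadBalancing.numEmpty (LoadBalancing.load a) →
          (LoadBalancing.round a).toMeasure
              {a' | LoadBalancing.numEmpty (LoadBalancing.load a') < Nat.sqrt n} ≤
            ENNReal.ofReal (Real.exp (-(c * √(n : ℝ)))))) := by
  refine ⟨0.002, by norm_num, 10 ^ 8, fun n hn => ⟨?_, fun a ha => ?_⟩⟩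
  · intro Ω _ P _ A hA h0
    exact ⟨LoadBalancing.exp_le_lintegral_nashTime hn hA h0, hA.lintegral_nashTime_lt_top⟩
  · refine (LoadBalancing.round_numEmpty_lt_sqrt_le hn a ha).trans
      (ENNReal.ofReal_le_ofReal (Real.exp_le_exp.2 ?_))
    have := Real.sqrt_nonneg (n : ℝ)
    norm_num
    linarith
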